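/- Let $d\ge 1$, let $\mathcal O\subset\mathbb R^d$ be a bounded domain (a nonempty, connected, bounded open set; no regularity of the boundary is needed), and let $2\le p<\infty$, $p'=\frac{p}{p-1}$. Let $H_0^1(\mathcal O)$ be the closure of $C_c^\infty(\mathcal O)$ in the real Sobolev space $H^1(\mathcal O)$, let $H^{-1}(\mathcal O)$ be its dual, taken with respect to the norm $\|\nabla v\|_{L^2(\mathcal O)}$ on $H_0^1(\mathcal O)$, and let $L^{p'}(\mathcal O)+H^{-1}(\mathcal O)$ be the space of all functionals on $L^p(\mathcal O)\cap H_0^1(\mathcal O)$ of the form $v\mapsto\int_{\mathcal O} g\,v\,dx+\langle T,v\rangle$ with $g\in L^{p'}(\mathcal O)$ and $T\in H^{-1}(\mathcal O)$. For $u\in L^p(\mathcal O)\cap H_0^1(\mathcal O)$ put $$\mathcal E(u)=\frac12\int_{\mathcal O}|\nabla u|^2\,dx+\frac1p\int_{\mathcal O}|u|^p\,dx .$$ Then $\mathcal E$ attains its minimum on the set $$\{u\in L^p(\mathcal O)\cap H_0^1(\mathcal O):\ \|u\|_{L^2(\mathcal O)}=1\},$$ and every minimizer $u$ is a ground state, that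 is, it also solves the stationary equation $$\Delta u-|u|^{p-2}u+\big(\|\nabla u\|_{L^2(\mathcal O)}^2+\|u\|_{L^p(\mathcal O)}^p\big)u=0\quad\text{in } L^{p'}(\mathcal O)+H^{-1}(\mathcal O),$$ where $\Delta u\in H^{-1}(\mathcal O)$ is given by $\langle\Delta u,v\rangle=-\int_{\mathcal O}\nabla u\cdot\nabla v\,dx$ for $v\in H_0^1(\mathcal O)$. In particular a ground state exists. -/

import Mathlib

open MeasureTheory
open scoped ENNReal ContDiff Distributions Gradient

noncomputable section

/-- A bounded domain of `ℝ^d`: a nonempty connected bounded open set. -/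
structure BoundedDomain (d : ℕ) extends
    TopologicalSpace.Opens (EuclideanSpace ℝ (Fin d)) where
  isConnected : IsConnected carrier
  isBounded : Bornology.IsBounded carrier

namespace BoundedDomain

variable {d : ℕ} (O : BoundedDomain d)

/-- Lebesgue measure on the domain. -/
abbrev vol : Measure (EuclideanSpace ℝ (Fin d)) := volume.restrict O.carrier

instance : IsFiniteMeasure O.vol :=
  isFiniteMeasure_restrict.2 O.isBounded.measure_lt_top.ne

/-- The space `L^q(O)` of (classes of) real functions. -/
abbrev L (q : ℝ≥0∞) := Lp ℝ q O.vol

/-- The space `L^2(O; ℝ^d)` of square integrable vector fields. -/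
abbrev L2Vec := Lp (EuclideanSpace ℝ (Fin d)) 2 O.vol

/-- `G` is the weak gradient of `u`: `∫_O u ∂ᵢφ = -∫_O Gᵢ φ` for all `φ ∈ C_c^∞(O)` and all `i`. -/
def IsWeakGrad (u : O.L 2) (G : O.L2Vec) : Prop :=
  ∀ φ : 𝓓(O.toOpens, ℝ), ∀ i : Fin d,
    ∫ x, u x * fderiv ℝ φ x (EuclideanSpace.single i 1) ∂O.vol = - ∫ x, G x i * φ x ∂O.vol

section helpers

variable {O}

theorem integrable_mul_fderiv (u : O.L 2) (φ : 𝓓(O.toOpens, ℝ)) (i : Fin d) :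
    Integrable (fun x => u x * fderiv ℝ φ x (EuclideanSpace.single i 1)) O.vol := by
  have hc : Continuous fun x => fderiv ℝ φ x (EuclideanSpace.single i 1) :=
    (φ.contDiff.continuous_fderiv (by simp)).clm_apply continuous_const
  have hs : HasCompactSupport fun x => fderiv ℝ φ x (EuclideanSpace.single i 1) :=
    φ.hasCompactSupport.fderiv_apply (𝕜 := ℝ) _
  exact (Lp.memLp u).integrable_mul (q := 2) (hc.memLp_of_hasCompactSupport hs)

theorem memLp_coord (G : O.L2Vec) (i : Fin d) : MemLp (fun x => G x i) 2 O.vol :=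
  (Lp.memLp G).continuousLinearMap_comp (EuclideanSpace.proj i : _ →L[ℝ] ℝ)

theorem integrable_coord_mul (G : O.L2Vec) (φ : 𝓓(O.toOpens, ℝ)) (i : Fin d) :
    Integrable (fun x => G x i * φ x) O.vol :=
  (memLp_coord G i).integrable_mul (q := 2)
    (φ.continuous.memLp_of_hasCompactSupport φ.hasCompactSupport)

theorem IsWeakGrad.add {u v : O.L 2} {G H : O.L2Vec} (hu : O.IsWeakGrad u G)
    (hv : O.IsWeakGrad v H) : O.IsWeakGrad (u + v) (G + H) := by
  intro φ i
  have e1 : ∫ x, (u + v : O.L 2) x * fderiv ℝ φ x (EuclideanSpace.single i 1) ∂O.vol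
      = ∫ x, (u x * fderiv ℝ φ x (EuclideanSpace.single i 1)
        + v x * fderiv ℝ φ x (EuclideanSpace.single i 1)) ∂O.vol := by
    refine integral_congr_ae ?_
    filter_upwards [Lp.coeFn_add u v] with x hx
    rw [hx, Pi.add_apply, add_mul]
  have e2 : ∫ x, (G + H : O.L2Vec) x i * φ x ∂O.vol
      = ∫ x, (G x i * φ x + H x i * φ x) ∂O.vol := by
    refine integral_congr_ae ?_
    filter_upwards [Lp.coeFn_add G H] with x hx
    rw [hx, Pi.add_apply, PiLp.add_apply, add_mul]
  rw [e1, e2, integral_add (integrable_mul_fderiv u φ i) (integrable_mul_fderiv v φ i),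
    integral_add (integrable_coord_mul G φ i) (integrable_coord_mul H φ i), hu φ i, hv φ i]
  ring

theorem IsWeakGrad.smul (c : ℝ) {u : O.L 2} {G : O.L2Vec} (hu : O.IsWeakGrad u G) :
    O.IsWeakGrad (c • u) (c • G) := by
  intro φ i
  have e1 : ∫ x, (c • u : O.L 2) x * fderiv ℝ φ x (EuclideanSpace.single i 1) ∂O.vol
      = ∫ x, c * (u x * fderiv ℝ φ x (EuclideanSpace.single i 1)) ∂O.vol := by
    refine integral_congr_ae ?_
    filter_upwards [Lp.coeFn_smul c u] with x hx
    rw [hx, Pi.smul_apply, smul_eq_mul, mul_assoc]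
  have e2 : ∫ x, (c • G : O.L2Vec) x i * φ x ∂O.vol = ∫ x, c * (G x i * φ x) ∂O.vol := by
    refine integral_congr_ae ?_
    filter_upwards [Lp.coeFn_smul c G] with x hx
    rw [hx, Pi.smul_apply, PiLp.smul_apply, smul_eq_mul, mul_assoc]
  rw [e1, e2, integral_const_mul, integral_const_mul, hu φ i]
  ring

theorem IsWeakGrad.zero : O.IsWeakGrad 0 0 := by
  intro φ i
  have e1 : ∫ x, (0 : O.L 2) x * fderiv ℝ φ x (EuclideanSpace.single i 1) ∂O.vol = 0 := by
    refine integral_eq_zero_of_ae ?_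
    filter_upwards [Lp.coeFn_zero ℝ 2 O.vol] with x hx
    rw [hx]; simp
  have e2 : ∫ x, (0 : O.L2Vec) x i * φ x ∂O.vol = 0 := by
    refine integral_eq_zero_of_ae ?_
    filter_upwards [Lp.coeFn_zero (EuclideanSpace ℝ (Fin d)) 2 O.vol] with x hx
    rw [hx]; simp
  rw [e1, e2, neg_zero]

/-- A function has at most one weak gradient. -/
theorem IsWeakGrad.unique {u : O.L 2} {G H : O.L2Vec} (hG : O.IsWeakGrad u G)
    (hH : O.IsWeakGrad u H) : G = H := by
  have key : ∀ i : Fin d, ∀ᵐ x ∂O.vol, G x i = H x i := by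
    intro i
    have hint : Integrable (fun x => G x i - H x i) O.vol :=
      ((memLp_coord G i).sub (memLp_coord H i)).integrable (by norm_num)
    have h := IsOpen.ae_eq_zero_of_integral_contDiff_smul_eq_zero (μ := O.vol) O.is_open'
      (hint.locallyIntegrable.locallyIntegrableOn _) (fun g hg hgc hgs => by
        let φ : 𝓓(O.toOpens, ℝ) := ⟨g, hg, hgc, hgs⟩
        have h1 := hG φ i
        rw [hH φ i, neg_inj] at h1
        have h2 : ∀ x, g x • (G x i - H x i) = G x i * φ x - H x i * φ x := by
          intro x
          change g x * (G x i - H x i) = G x i * g x - H x i * g x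
          ring
        simp_rw [h2]
        rw [integral_sub (integrable_coord_mul G φ i) (integrable_coord_mul H φ i), h1, sub_self])
    filter_upwards [h, ae_restrict_mem O.is_open'.measurableSet] with x hx hxO
    exact sub_eq_zero.1 (hx hxO)
  apply Lp.ext
  filter_upwards [ae_all_iff.2 key] with x hx
  ext i
  exact hx i

theorem memLp_gradient (φ : 𝓓(O.toOpens, ℝ)) : MemLp (∇ φ) 2 O.vol := by
  have hc : Continuous (∇ φ) :=
    (InnerProductSpace.toDual ℝ _).symm.continuous.comp
      (φ.contDiff.continuous_fderiv (by simp))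
  have hs : HasCompactSupport (∇ φ) :=
    (φ.hasCompactSupport.fderiv (𝕜 := ℝ)).comp_left (map_zero _)
  exact hc.memLp_of_hasCompactSupport hs

theorem gradient_add (φ ψ : 𝓓(O.toOpens, ℝ)) : ∇ (φ + ψ : 𝓓(O.toOpens, ℝ)) = ∇ φ + ∇ ψ := by
  funext x
  have h1 : DifferentiableAt ℝ φ x := (φ.contDiff.differentiable (by simp)) x
  have h2 : DifferentiableAt ℝ ψ x := (ψ.contDiff.differentiable (by simp)) x
  have h3 : fderiv ℝ (φ + ψ : 𝓓(O.toOpens, ℝ)) x = fderiv ℝ φ x + fderiv ℝ ψ x :=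
    fderiv_add h1 h2
  simp only [gradient, Pi.add_apply, h3, map_add]

theorem gradient_smul (c : ℝ) (φ : 𝓓(O.toOpens, ℝ)) :
    ∇ (c • φ : 𝓓(O.toOpens, ℝ)) = c • ∇ φ := by
  funext x
  have h1 : DifferentiableAt ℝ φ x := (φ.contDiff.differentiable (by simp)) x
  have h3 : fderiv ℝ (c • φ : 𝓓(O.toOpens, ℝ)) x = c • fderiv ℝ φ x :=
    fderiv_const_smul h1 c
  simp only [gradient, Pi.smul_apply, h3, map_smul]

theorem memLp_testFunction (φ : 𝓓(O.toOpens, ℝ)) : MemLp φ 2 O.vol :=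
  φ.continuous.memLp_of_hasCompactSupport φ.hasCompactSupport

end helpers

/-- The Sobolev space `H^1(O)`: the `u ∈ L^2(O)` with a weak gradient in `L^2(O; ℝ^d)`. -/
def H1 : Submodule ℝ (O.L 2) where
  carrier := {u | ∃ G, O.IsWeakGrad u G}
  add_mem' := fun ⟨G, hG⟩ ⟨H, hH⟩ => ⟨G + H, hG.add hH⟩
  zero_mem' := ⟨0, IsWeakGrad.zero⟩
  smul_mem' := fun c _ ⟨G, hG⟩ => ⟨c • G, hG.smul c⟩

/-- The weak gradient `u ↦ ∇u`, `H^1(O) → L^2(O; ℝ^d)`. -/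
def grad : O.H1 →ₗ[ℝ] O.L2Vec where
  toFun u := u.2.choose
  map_add' u v := (u + v).2.choose_spec.unique (u.2.choose_spec.add v.2.choose_spec)
  map_smul' c u := (c • u).2.choose_spec.unique (u.2.choose_spec.smul c)

theorem isWeakGrad_grad (u : O.H1) : O.IsWeakGrad u (O.grad u) := u.2.choose_spec

/-- The linear map `φ ↦ (φ, ∇φ)`, `C_c^∞(O) → L^2(O) × L^2(O; ℝ^d)` (classical gradient). -/
def testPair : 𝓓(O.toOpens, ℝ) →ₗ[ℝ] O.L 2 × O.L2Vec where
  toFun φ := ((memLp_testFunction φ).toLp φ, (memLp_gradient φ).toLp (∇ φ))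
  map_add' φ ψ := by
    refine Prod.ext ?_ ?_
    · exact MemLp.toLp_add (memLp_testFunction φ) (memLp_testFunction ψ)
    · exact (MemLp.toLp_congr (memLp_gradient (φ + ψ))
        ((memLp_gradient φ).add (memLp_gradient ψ)) (.of_eq (gradient_add φ ψ))).trans
        (MemLp.toLp_add (memLp_gradient φ) (memLp_gradient ψ))
  map_smul' c φ := by
    refine Prod.ext ?_ ?_
    · exact MemLp.toLp_const_smul c (memLp_testFunction φ)
    · exact (MemLp.toLp_congr (memLp_gradient (c • φ))
        ((memLp_gradient φ).const_smul c) (.of_eq (gradient_smul c φ))).trans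
        (MemLp.toLp_const_smul c (memLp_gradient φ))

/-- The Sobolev space `H_0^1(O)`: the closure of `C_c^∞(O)` in `H^1(O)`, that is, the
`u ∈ H^1(O)` for which there are `φ_n ∈ C_c^∞(O)` with `φ_n → u` and `∇φ_n → ∇u` in `L^2`. -/
def H01 : Submodule ℝ O.H1 :=
  (LinearMap.range O.testPair).topologicalClosure.comap (O.H1.subtype.prod O.grad)

/-- The space `L^p(O) ∩ H_0^1(O)`. -/
def LpH01 (p : ℝ) : Submodule ℝ O.H1 where
  carrier := {u | u ∈ O.H01 ∧ MemLp (u : O.L 2) (ENNReal.ofReal p) O.vol}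
  add_mem' {u v} hu hv := ⟨O.H01.add_mem hu.1 hv.1,
    (memLp_congr_ae (Lp.coeFn_add (u : O.L 2) (v : O.L 2))).2 (hu.2.add hv.2)⟩
  zero_mem' := ⟨O.H01.zero_mem, (memLp_congr_ae (Lp.coeFn_zero ℝ 2 O.vol)).2 MemLp.zero⟩
  smul_mem' c u hu := ⟨O.H01.smul_mem c hu.1,
    (memLp_congr_ae (Lp.coeFn_smul c (u : O.L 2))).2 (hu.2.const_smul c)⟩

/-- The inclusion `L^p(O) ∩ H_0^1(O) ⊆ H_0^1(O)`. -/
def inclH01 (p : ℝ) : O.LpH01 p →ₗ[ℝ] O.H01 :=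
  Submodule.inclusion fun _ hu => hu.1

/-- `‖∇u‖_{L^2}^2 = ∫_O |∇u|^2`. -/
def gradSq (u : O.H1) : ℝ := ∫ x, ‖O.grad u x‖ ^ 2 ∂O.vol

/-- `‖u‖_{L^p}^p = ∫_O |u|^p`. -/
def powInt (p : ℝ) (u : O.H1) : ℝ := ∫ x, |(u : O.L 2) x| ^ p ∂O.vol

/-- The energy `E(u) = 1/2 ∫_O |∇u|^2 + 1/p ∫_O |u|^p` on `L^p(O) ∩ H_0^1(O)`. -/
def energy (p : ℝ) (u : O.LpH01 p) : ℝ := 1 / 2 * O.gradSq u + 1 / p * O.powInt p u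

/-- The constraint set: the `u ∈ L^p(O) ∩ H_0^1(O)` with `‖u‖_{L^2} = 1`. -/
def sphere (p : ℝ) : Set (O.LpH01 p) := {u | ‖((u : O.H1) : O.L 2)‖ = 1}

/-- `u` solves the problem of minimizing the energy on the constraint set. -/
def IsMinimizer (p : ℝ) (u : O.LpH01 p) : Prop :=
  u ∈ O.sphere p ∧ IsMinOn (O.energy p) (O.sphere p) u

/-- `H^{-1}(O)`: the linear functionals on `H_0^1(O)` that are bounded for the norm
`‖v‖_{H_0^1} = ‖∇v‖_{L^2}`. -/
def Hm1 : Submodule ℝ (Module.Dual ℝ O.H01) where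
  carrier := {T | ∃ C : ℝ, ∀ v, |T v| ≤ C * ‖O.grad v‖}
  add_mem' := fun {S T} ⟨A, hA⟩ ⟨B, hB⟩ => ⟨A + B, fun v => by
    rw [LinearMap.add_apply, add_mul]
    exact (abs_add_le _ _).trans (add_le_add (hA v) (hB v))⟩
  zero_mem' := ⟨0, fun v => by simp⟩
  smul_mem' := fun c T ⟨A, hA⟩ => ⟨|c| * A, fun v => by
    rw [LinearMap.smul_apply, smul_eq_mul, abs_mul, mul_assoc]
    exact mul_le_mul_of_nonneg_left (hA v) (abs_nonneg c)⟩

/-- The Laplacian `Δ : H_0^1(O) → H^{-1}(O)`, `⟨Δu, v⟩ = -(∇u, ∇v)_{L^2}`. -/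
def laplacian (u : O.H01) : O.Hm1 :=
  ⟨-((innerₗ O.L2Vec (O.grad u)).comp (O.grad.comp O.H01.subtype)),
    ‖O.grad u‖, fun v => by
      rw [LinearMap.neg_apply, abs_neg]
      exact abs_real_inner_le_norm (O.grad u) (O.grad v)⟩

/-- The conjugate exponent `p' = p / (p - 1)`. -/
def conjExp (p : ℝ) : ℝ≥0∞ := ENNReal.ofReal (p / (p - 1))

theorem conjExp_holder {p : ℝ} (hp : 2 ≤ p) :
    (conjExp p).HolderConjugate (ENNReal.ofReal p) :=
  (Real.HolderConjugate.conjExponent (by linarith : 1 < p)).symm.ennrealOfReal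

theorem conjExp_le_two {p : ℝ} (hp : 2 ≤ p) : conjExp p ≤ 2 := by
  rw [conjExp, ← ENNReal.ofReal_ofNat 2]
  refine ENNReal.ofReal_le_ofReal ?_
  rw [div_le_iff₀ (by linarith)]
  linarith

theorem integrable_pairing {p : ℝ} (hp : 2 ≤ p) (g : O.L (conjExp p)) (v : O.LpH01 p) :
    Integrable (fun x => g x * ((v : O.H1) : O.L 2) x) O.vol :=
  haveI := conjExp_holder hp
  (Lp.memLp g).integrable_mul v.2.2

/-- `g ∈ L^{p'}(O)` as a functional on `L^p(O) ∩ H_0^1(O)`: `⟨g, v⟩ = ∫_O g v`. -/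
def lpPairing {p : ℝ} (hp : 2 ≤ p) : O.L (conjExp p) →ₗ[ℝ] Module.Dual ℝ (O.LpH01 p) :=
  LinearMap.mk₂ ℝ (fun g v => ∫ x, g x * ((v : O.H1) : O.L 2) x ∂O.vol)
    (fun g h v => by
      rw [← integral_add (O.integrable_pairing hp g v) (O.integrable_pairing hp h v)]
      refine integral_congr_ae ?_
      filter_upwards [Lp.coeFn_add g h] with x hx
      rw [hx, Pi.add_apply, add_mul])
    (fun c g v => by
      rw [smul_eq_mul, ← integral_const_mul]
      refine integral_congr_ae ?_
      filter_upwards [Lp.coeFn_smul c g] with x hx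
      rw [hx, Pi.smul_apply, smul_eq_mul, mul_assoc])
    (fun g v w => by
      rw [← integral_add (O.integrable_pairing hp g v) (O.integrable_pairing hp g w)]
      refine integral_congr_ae ?_
      filter_upwards [Lp.coeFn_add ((v : O.H1) : O.L 2) ((w : O.H1) : O.L 2)] with x hx
      have h : (((v + w : O.LpH01 p) : O.H1) : O.L 2) x
          = ((v : O.H1) : O.L 2) x + ((w : O.H1) : O.L 2) x := hx
      rw [h, mul_add])
    (fun c g v => by
      rw [smul_eq_mul, ← integral_const_mul]
      refine integral_congr_ae ?_
      filter_upwards [Lp.coeFn_smul c ((v : O.H1) : O.L 2)] with x hx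
      have h : (((c • v : O.LpH01 p) : O.H1) : O.L 2) x = c * ((v : O.H1) : O.L 2) x := hx
      rw [h, mul_left_comm])

/-- The space `L^{p'}(O) + H^{-1}(O)` of all functionals `v ↦ ∫_O g v + ⟨T, v⟩` on
`L^p(O) ∩ H_0^1(O)`, with `g ∈ L^{p'}(O)` and `T ∈ H^{-1}(O)`. -/
def SumSpace {p : ℝ} (hp : 2 ≤ p) : Submodule ℝ (Module.Dual ℝ (O.LpH01 p)) :=
  LinearMap.range (O.lpPairing hp) ⊔ O.Hm1.map (O.inclH01 p).dualMap

/-- The inclusion of `L^{p'}(O)` in `L^{p'}(O) + H^{-1}(O)`. -/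
def ofLp {p : ℝ} (hp : 2 ≤ p) (g : O.L (conjExp p)) : O.SumSpace hp :=
  ⟨O.lpPairing hp g, Submodule.mem_sup_left (LinearMap.mem_range_self _ g)⟩

/-- The inclusion of `H^{-1}(O)` in `L^{p'}(O) + H^{-1}(O)`. -/
def ofHm1 {p : ℝ} (hp : 2 ≤ p) (T : O.Hm1) : O.SumSpace hp :=
  ⟨(O.inclH01 p).dualMap T, Submodule.mem_sup_right (Submodule.mem_map_of_mem T.2)⟩

theorem memLp_nonlinearity {p : ℝ} (hp : 2 ≤ p) (u : O.LpH01 p) :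
    MemLp (fun x => |((u : O.H1) : O.L 2) x| ^ (p - 2) * ((u : O.H1) : O.L 2) x)
      (conjExp p) O.vol := by
  have hm : AEStronglyMeasurable ((u : O.H1) : O.L 2) O.vol := (Lp.memLp _).1
  have h := u.2.2.norm_rpow_div (ENNReal.ofReal (p - 1))
  rw [← ENNReal.ofReal_div_of_pos (by linarith), ENNReal.toReal_ofReal (by linarith)] at h
  refine h.of_le ?_ (Filter.Eventually.of_forall fun x => ?_)
  · exact ((hm.norm.aemeasurable.pow_const (p - 2)).mul hm.aemeasurable).aestronglyMeasurable
  · have e : |((u : O.H1) : O.L 2) x| ^ (p - 2) * |((u : O.H1) : O.L 2) x|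
        = |((u : O.H1) : O.L 2) x| ^ (p - 1) := by
      rw [← Real.rpow_add_one' (abs_nonneg _) (by linarith)]
      congr 1; ring
    simp only [Real.norm_eq_abs, abs_mul, Real.abs_rpow_of_nonneg (abs_nonneg _), abs_abs, e,
      le_refl]

/-- The nonlinearity `|u|^{p-2} u ∈ L^{p'}(O)`. -/
def nonlinearity {p : ℝ} (hp : 2 ≤ p) (u : O.LpH01 p) : O.L (conjExp p) :=
  (O.memLp_nonlinearity hp u).toLp _

/-- `u` itself as an element of `L^{p'}(O)`; note that `p' ≤ 2` and `O` is bounded. -/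
def toLpConj {p : ℝ} (hp : 2 ≤ p) (u : O.LpH01 p) : O.L (conjExp p) :=
  ((Lp.memLp ((u : O.H1) : O.L 2)).mono_exponent (conjExp_le_two hp)).toLp _

/-- `Δu - |u|^{p-2} u + (‖∇u‖_{L^2}^2 + ‖u‖_{L^p}^p) u`, in `L^{p'}(O) + H^{-1}(O)`. -/
def stationary {p : ℝ} (hp : 2 ≤ p) (u : O.LpH01 p) : O.SumSpace hp :=
  O.ofHm1 hp (O.laplacian (O.inclH01 p u)) - O.ofLp hp (O.nonlinearity hp u)
    + (O.gradSq u + O.powInt p u) • O.ofLp hp (O.toLpConj hp u)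

/-- A ground state: a minimizer of the energy on the constraint set which solves the stationary
equation `Δu - |u|^{p-2} u + (‖∇u‖_{L^2}^2 + ‖u‖_{L^p}^p) u = 0` in `L^{p'}(O) + H^{-1}(O)`. -/
def IsGroundState {p : ℝ} (hp : 2 ≤ p) (u : O.LpH01 p) : Prop :=
  O.IsMinimizer p u ∧ O.stationary hp u = 0

end BoundedDomain

end

/-!
Existence of a ground state is proved by the direct method. A minimizing sequence `u_n` for the
energy on the `L²` unit sphere is bounded in `H_0^1(O)`, so a subsequence of the pairs
`(u_n, ∇u_n)` converges weakly in `L² × L²`; the limit is again a pair `(w, ∇w)` with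
`w ∈ H_0^1(O)`, since weak gradients pass to weak limits and closed subspaces are weakly closed.

The one compactness input is Rellich's theorem for `H_0^1(O)` (`tendsto_of_tendsto_inner`), which
needs only that `O` is bounded. It is reduced by density to test functions
(`tendsto_testPair_zero`) and read off on the Fourier side: at each frequency the Fourier transform
of a function supported in `O` is an `L²(O)` pairing with a bounded function, so weak convergence
gives pointwise convergence with a uniform bound, hence convergence of the `L²` norm over every
ball of frequencies, while Plancherel bounds the mass at frequencies `|ξ| ≥ R` by
`‖∇φ‖² / (2πR)²`. Hence `w` lies on the sphere. The gradient term of the energy is weakly lower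
semicontinuous, the `L^p` term is handled by Fatou's lemma (`memLp_and_powInt_le`), and `w`
minimizes the energy (`exists_isMinimizer`).

For the equation, given a minimizer `u` and a direction `v`, the energy of
`(u + t v) / ‖u + t v‖_{L²}` has a minimum at `t = 0`. Its derivative there is
`⟨∇u, ∇v⟩ + ∫ |u|^{p-2} u v - (‖∇u‖² + ‖u‖_p^p) ⟨u, v⟩`, where the multiplier arises from the
homogeneity of degrees `2` and `p` of the two terms of the energy
(`IsMinimizer.euler_lagrange`).
-/

open Filter Topology

/-! ### Weak convergence in Hilbert spaces -/

/-- Bounded sequences in a separable Hilbert space have weakly convergent subsequences. -/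
theorem exists_subseq_tendsto_inner {H : Type*} [NormedAddCommGroup H] [InnerProductSpace ℝ H]
    [CompleteSpace H] [TopologicalSpace.SeparableSpace H] {x : ℕ → H} {C : ℝ}
    (hx : ∀ n, ‖x n‖ ≤ C) :
    ∃ (a : H) (k : ℕ → ℕ), StrictMono k ∧
      ∀ y, Tendsto (fun n => inner ℝ (x (k n)) y) atTop (𝓝 (inner ℝ a y)) := by
  have hmem : ∀ n, StrongDual.toWeakDual (InnerProductSpace.toDual ℝ H (x n)) ∈
      WeakDual.toStrongDual ⁻¹' Metric.closedBall (0 : StrongDual ℝ H) C := by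
    intro n
    simpa using! hx n
  obtain ⟨a, -, k, hk, hlim⟩ := WeakDual.isSeqCompact_closedBall ℝ H 0 C hmem
  refine ⟨(InnerProductSpace.toDual ℝ H).symm (WeakDual.toStrongDual a), k, hk, fun y => ?_⟩
  have := ((WeakDual.eval_continuous y).tendsto a).comp hlim
  simpa [Function.comp_def] using! this

/-- A closed subspace of a product of Hilbert spaces is weakly sequentially closed. Weak convergence
is expressed componentwise because `H × K` carries the sup norm and has no inner product. -/
theorem Submodule.mem_of_tendsto_inner_prod {H K : Type*}
    [NormedAddCommGroup H] [InnerProductSpace ℝ H] [CompleteSpace H]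
    [NormedAddCommGroup K] [InnerProductSpace ℝ K] [CompleteSpace K]
    {S : Submodule ℝ (H × K)} (hS : IsClosed (S : Set (H × K))) {x : ℕ → H × K} {a : H × K}
    (hx : ∀ n, x n ∈ S)
    (h₁ : ∀ y, Tendsto (fun n => inner ℝ (x n).1 y) atTop (𝓝 (inner ℝ a.1 y)))
    (h₂ : ∀ y, Tendsto (fun n => inner ℝ (x n).2 y) atTop (𝓝 (inner ℝ a.2 y))) : a ∈ S := by
  by_contra ha
  obtain ⟨f, s, hfs, hsa⟩ := geometric_hahn_banach_closed_point S.convex hS ha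
  -- a functional bounded above on a subspace vanishes there
  have hf0 : ∀ z ∈ S, f z = 0 := by
    intro z hz
    by_contra hne
    have := hfs ((s / f z) • z) (S.smul_mem _ hz)
    rw [map_smul, smul_eq_mul, div_mul_cancel₀ _ hne] at this
    exact lt_irrefl _ this
  let p := (InnerProductSpace.toDual ℝ H).symm (f.comp (ContinuousLinearMap.inl ℝ H K))
  let q := (InnerProductSpace.toDual ℝ K).symm (f.comp (ContinuousLinearMap.inr ℝ H K))
  have hf : ∀ z, f z = inner ℝ z.1 p + inner ℝ z.2 q := by
    intro z
    rw [real_inner_comm, real_inner_comm q]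
    simp only [p, q, InnerProductSpace.toDual_symm_apply, ContinuousLinearMap.comp_apply,
      ContinuousLinearMap.inl_apply, ContinuousLinearMap.inr_apply]
    rw [← map_add]
    simp
  have hlim : Tendsto (fun n => f (x n)) atTop (𝓝 (f a)) := by
    simp_rw [hf]
    exact (h₁ p).add (h₂ q)
  have h0 : f a = 0 := tendsto_nhds_unique hlim (by simp [hf0 _ (hx _)])
  have := hfs 0 S.zero_mem
  rw [map_zero] at this
  linarith

/-! ### Fourier estimates for Schwartz functions -/

open scoped FourierTransform SchwartzMap LineDeriv

theorem SchwartzMap.integrable_norm_sq {d : ℕ} (f : 𝓢(EuclideanSpace ℝ (Fin d), ℂ)) :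
    Integrable (fun x => ‖f x‖ ^ 2) :=
  (memLp_two_iff_integrable_sq_norm f.continuous.aestronglyMeasurable).1 (f.memLp 2)

/-- The `i`-th partial derivative of a Schwartz function. -/
noncomputable def SchwartzMap.partialDeriv {d : ℕ} (i : Fin d)
    (f : 𝓢(EuclideanSpace ℝ (Fin d), ℂ)) : 𝓢(EuclideanSpace ℝ (Fin d), ℂ) :=
  ∂_{EuclideanSpace.single i (1 : ℝ)} f

/-- The partial derivative `∂ᵢ` acts on the Fourier side as multiplication by `2πi ξᵢ`; the squares
of these factors add up to `(2π‖ξ‖)²`. -/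
theorem SchwartzMap.norm_sq_mul_norm_sq_fourier {d : ℕ} (f : 𝓢(EuclideanSpace ℝ (Fin d), ℂ))
    (ξ : EuclideanSpace ℝ (Fin d)) :
    (2 * Real.pi * ‖ξ‖) ^ 2 * ‖𝓕 f ξ‖ ^ 2
      = ∑ i, ‖𝓕 (f.partialDeriv i) ξ‖ ^ 2 := by
  have h : ∀ i, ‖𝓕 (f.partialDeriv i) ξ‖ ^ 2
      = (2 * Real.pi) ^ 2 * ‖𝓕 f ξ‖ ^ 2 * ‖ξ i‖ ^ 2 := by
    intro i
    have ht : (inner ℝ · (EuclideanSpace.single i (1 : ℝ)) :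
      EuclideanSpace ℝ (Fin d) → ℝ).HasTemperateGrowth := by fun_prop
    rw [SchwartzMap.partialDeriv, SchwartzMap.fourier_lineDerivOp_eq, smul_apply,
      SchwartzMap.smulLeftCLM_apply_apply ht]
    simp only [EuclideanSpace.inner_single_right, norm_smul, mul_pow, norm_mul, Complex.norm_I,
      Complex.norm_real, Complex.norm_ofNat, Real.norm_eq_abs, sq_abs, conj_trivial, one_mul]
    ring
  simp_rw [h]
  rw [← Finset.mul_sum, ← EuclideanSpace.norm_sq_eq]
  ring

/-- The `L²` mass of `f` is controlled by the frequencies below `R`, up to an error of the size of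
the gradient divided by `2πR`. -/
theorem SchwartzMap.integral_norm_sq_le {d : ℕ} (f : 𝓢(EuclideanSpace ℝ (Fin d), ℂ)) {R : ℝ}
    (hR : 0 < R) :
    ∫ x, ‖f x‖ ^ 2 ≤ (∫ ξ in Metric.ball 0 R, ‖𝓕 f ξ‖ ^ 2)
      + ((2 * Real.pi * R) ^ 2)⁻¹ *
        ∑ i, ∫ x, ‖f.partialDeriv i x‖ ^ 2 := by
  rw [← SchwartzMap.integral_norm_sq_fourier,
    ← integral_add_compl Metric.isOpen_ball.measurableSet (SchwartzMap.integrable_norm_sq (𝓕 f))]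
  refine add_le_add le_rfl ?_
  have hint : Integrable fun ξ => ∑ i, ‖𝓕 (f.partialDeriv i) ξ‖ ^ 2 :=
    integrable_finsetSum _ fun i _ => SchwartzMap.integrable_norm_sq _
  have e : ((2 * Real.pi * R) ^ 2)⁻¹ *
        ∑ i, ∫ x, ‖f.partialDeriv i x‖ ^ 2
      = ∫ ξ, ((2 * Real.pi * R) ^ 2)⁻¹ *
        ∑ i, ‖𝓕 (f.partialDeriv i) ξ‖ ^ 2 := by
    rw [integral_const_mul, integral_finsetSum _ fun i _ => SchwartzMap.integrable_norm_sq _]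
    simp_rw [SchwartzMap.integral_norm_sq_fourier]
  rw [e]
  refine le_trans (setIntegral_mono_on (SchwartzMap.integrable_norm_sq _).integrableOn
    (hint.const_mul _).integrableOn Metric.isOpen_ball.measurableSet.compl fun ξ hξ => ?_)
    (setIntegral_le_integral (hint.const_mul _) (ae_of_all _ fun ξ => by positivity))
  rw [← SchwartzMap.norm_sq_mul_norm_sq_fourier, inv_mul_eq_div, le_div_iff₀ (by positivity),
    mul_comm]
  have : R ≤ ‖ξ‖ := by simpa using hξ
  gcongr

/-! ### Rellich compactness for test functions -/

namespace BoundedDomain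

variable {d : ℕ} {O : BoundedDomain d}

theorem setIntegral_eq_integral_of_support {E : Type*} [NormedAddCommGroup E] [NormedSpace ℝ E]
    {f : EuclideanSpace ℝ (Fin d) → E} (hf : Function.support f ⊆ O.carrier) :
    ∫ x, f x ∂O.vol = ∫ x, f x :=
  setIntegral_eq_integral_of_forall_compl_eq_zero fun x hx => by
    by_contra h
    exact hx (hf h)

/-- A test function, complexified and regarded as a Schwartz function on `ℝ^d`. -/
noncomputable def toSchwartz (φ : 𝓓(O.toOpens, ℝ)) : 𝓢(EuclideanSpace ℝ (Fin d), ℂ) :=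
  (φ.hasCompactSupport.comp_left Complex.ofReal_zero).toSchwartzMap
    (Complex.ofRealCLM.contDiff.comp φ.contDiff)

theorem toSchwartz_apply (φ : 𝓓(O.toOpens, ℝ)) (x : EuclideanSpace ℝ (Fin d)) :
    toSchwartz φ x = (φ x : ℂ) := rfl

theorem gradient_apply (f : EuclideanSpace ℝ (Fin d) → ℝ) (x : EuclideanSpace ℝ (Fin d))
    (i : Fin d) : (∇ f x) i = fderiv ℝ f x (EuclideanSpace.single i 1) := by
  rw [← inner_gradient_left, EuclideanSpace.inner_single_right]; simp

theorem partialDeriv_toSchwartz (φ : 𝓓(O.toOpens, ℝ)) (i : Fin d) (x : EuclideanSpace ℝ (Fin d)) :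
    (toSchwartz φ).partialDeriv i x = ((∇ φ x) i : ℂ) := by
  have hd : DifferentiableAt ℝ φ x := φ.contDiff.differentiable (by simp) x
  have h : HasFDerivAt (toSchwartz φ) (Complex.ofRealCLM.comp (fderiv ℝ φ x)) x :=
    Complex.ofRealCLM.hasFDerivAt.comp x hd.hasFDerivAt
  rw [SchwartzMap.partialDeriv, SchwartzMap.lineDerivOp_apply_eq_fderiv, h.fderiv]
  rw [gradient_apply]; rfl

theorem norm_sq_toLp {F : Type*} [NormedAddCommGroup F] [InnerProductSpace ℝ F] (g : Lp F 2 O.vol) :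
    ‖g‖ ^ 2 = ∫ x, ‖g x‖ ^ 2 ∂O.vol := by
  rw [← real_inner_self_eq_norm_sq, L2.inner_def]
  simp_rw [real_inner_self_eq_norm_sq]

theorem norm_sq_testPair_fst (φ : 𝓓(O.toOpens, ℝ)) :
    ‖(O.testPair φ).1‖ ^ 2 = ∫ x, ‖toSchwartz φ x‖ ^ 2 := by
  rw [norm_sq_toLp]
  rw [← setIntegral_eq_integral_of_support (O := O)]
  · refine integral_congr_ae ?_
    filter_upwards [(memLp_testFunction φ).coeFn_toLp] with x hx
    have : (O.testPair φ).1 x = φ x := hx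
    rw [this, toSchwartz_apply]; simp
  · intro x hx
    refine φ.tsupport_subset (subset_tsupport _ fun h => hx ?_)
    simp [toSchwartz_apply, h]

theorem norm_sq_testPair_snd (φ : 𝓓(O.toOpens, ℝ)) :
    ‖(O.testPair φ).2‖ ^ 2
      = ∑ i, ∫ x, ‖(toSchwartz φ).partialDeriv i x‖ ^ 2 := by
  rw [norm_sq_toLp, ← integral_finsetSum _ fun i _ => SchwartzMap.integrable_norm_sq _]
  have e : ∀ x, ∑ i, ‖(toSchwartz φ).partialDeriv i x‖ ^ 2
      = ‖∇ φ x‖ ^ 2 := by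
    intro x
    simp_rw [partialDeriv_toSchwartz, Complex.norm_real, EuclideanSpace.norm_sq_eq]
  simp_rw [e]
  rw [← setIntegral_eq_integral_of_support (O := O)]
  · refine integral_congr_ae ?_
    filter_upwards [(memLp_gradient φ).coeFn_toLp] with x hx
    have : (O.testPair φ).2 x = ∇ φ x := hx
    rw [this]
  · intro x hx
    refine φ.tsupport_subset (support_fderiv_subset ℝ fun h => hx ?_)
    simp [gradient, h]

theorem norm_sq_testPair_le (φ : 𝓓(O.toOpens, ℝ)) {R : ℝ} (hR : 0 < R) :
    ‖(O.testPair φ).1‖ ^ 2 ≤ (∫ ξ in Metric.ball 0 R, ‖𝓕 (toSchwartz φ) ξ‖ ^ 2)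
      + ((2 * Real.pi * R) ^ 2)⁻¹ * ‖(O.testPair φ).2‖ ^ 2 := by
  rw [norm_sq_testPair_fst, norm_sq_testPair_snd]
  exact SchwartzMap.integral_norm_sq_le _ hR

theorem memLp_of_continuous_bounded {w : EuclideanSpace ℝ (Fin d) → ℝ} (hw : Continuous w)
    (h : ∀ x, |w x| ≤ 1) : MemLp w 2 O.vol :=
  MemLp.of_bound hw.aestronglyMeasurable 1 (ae_of_all _ h)

theorem inner_testPair_fst (φ : 𝓓(O.toOpens, ℝ)) {w : EuclideanSpace ℝ (Fin d) → ℝ}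
    (hw : MemLp w 2 O.vol) :
    inner ℝ (O.testPair φ).1 (hw.toLp w) = ∫ x, w x * φ x := by
  rw [L2.inner_def, ← setIntegral_eq_integral_of_support (O := O)]
  · refine integral_congr_ae ?_
    filter_upwards [(memLp_testFunction φ).coeFn_toLp, hw.coeFn_toLp] with x hx hx'
    have : (O.testPair φ).1 x = φ x := hx
    rw [this, hx']; simp
  · intro x hx
    refine φ.tsupport_subset (subset_tsupport _ fun h => hx ?_)
    simp [h]

/-- The Fourier transform of a test function at a fixed frequency consists of two `L²(O)` inner
products, against a cosine and a sine. -/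
theorem fourier_toSchwartz (ξ : EuclideanSpace ℝ (Fin d)) :
    ∃ c s : O.L 2, ‖c‖ ≤ √(O.vol.real Set.univ) ∧ ‖s‖ ≤ √(O.vol.real Set.univ) ∧
      ∀ φ : 𝓓(O.toOpens, ℝ), 𝓕 (toSchwartz φ) ξ
        = (inner ℝ (O.testPair φ).1 c : ℝ) - (inner ℝ (O.testPair φ).1 s : ℝ) * Complex.I := by
  have hc : MemLp (fun x => Real.cos (2 * Real.pi * inner ℝ x ξ)) 2 O.vol :=
    memLp_of_continuous_bounded (by fun_prop) fun x => Real.abs_cos_le_one _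
  have hs : MemLp (fun x => Real.sin (2 * Real.pi * inner ℝ x ξ)) 2 O.vol :=
    memLp_of_continuous_bounded (by fun_prop) fun x => Real.abs_sin_le_one _
  have hn : ∀ {w : EuclideanSpace ℝ (Fin d) → ℝ} (hw : MemLp w 2 O.vol), (∀ x, |w x| ≤ 1) →
      ‖hw.toLp w‖ ≤ √(O.vol.real Set.univ) := by
    intro w hw h1
    have := Lp.norm_le_of_ae_bound (f := hw.toLp w) zero_le_one (by
      filter_upwards [hw.coeFn_toLp] with x hx
      rw [hx]; exact h1 x)
    refine this.trans (le_of_eq ?_)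
    rw [Real.sqrt_eq_rpow, mul_one]
    simp [measureUnivNNReal, Measure.real, ENNReal.coe_toNNReal_eq_toReal]
  refine ⟨hc.toLp _, hs.toLp _, hn hc fun x => Real.abs_cos_le_one _,
    hn hs fun x => Real.abs_sin_le_one _, fun φ => ?_⟩
  rw [inner_testPair_fst, inner_testPair_fst, SchwartzMap.fourier_coe, Real.fourier_eq']
  have hi : ∀ w : EuclideanSpace ℝ (Fin d) → ℝ, Continuous w →
      Integrable fun x => w x * φ x := fun w hw =>
    (hw.mul φ.continuous).integrable_of_hasCompactSupport φ.hasCompactSupport.mul_left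
  rw [← integral_complex_ofReal, ← integral_complex_ofReal, ← integral_mul_const,
    ← integral_sub]
  · refine integral_congr_ae (ae_of_all _ fun x => ?_)
    simp only [toSchwartz_apply, smul_eq_mul]
    rw [Complex.exp_mul_I]
    push_cast
    simp only [neg_mul, Complex.cos_neg, Complex.sin_neg]
    ring
  · exact (hi _ (by fun_prop)).ofReal
  · exact (hi _ (by fun_prop)).ofReal.mul_const _

/-- **Rellich's theorem** for test functions: if `ψ n → 0` weakly in `L²(O)` with bounded gradients,
then `ψ n → 0` strongly in `L²(O)`. -/
theorem tendsto_testPair_zero {ψ : ℕ → 𝓓(O.toOpens, ℝ)} {A B : ℝ}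
    (hA : ∀ n, ‖(O.testPair (ψ n)).1‖ ≤ A) (hB : ∀ n, ‖(O.testPair (ψ n)).2‖ ≤ B)
    (hw : ∀ y, Tendsto (fun n => inner ℝ (O.testPair (ψ n)).1 y) atTop (𝓝 0)) :
    Tendsto (fun n => (O.testPair (ψ n)).1) atTop (𝓝 0) := by
  have hball : ∀ R : ℝ, Tendsto (fun n => ∫ ξ in Metric.ball 0 R, ‖𝓕 (toSchwartz (ψ n)) ξ‖ ^ 2)
      atTop (𝓝 0) := by
    intro R
    set V := √(O.vol.real Set.univ)
    have : IsFiniteMeasure ((volume : Measure (EuclideanSpace ℝ (Fin d))).restrict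
        (Metric.ball 0 R)) := isFiniteMeasure_restrict.2 Metric.isBounded_ball.measure_lt_top.ne
    have h := tendsto_integral_of_dominated_convergence
      (μ := (volume : Measure (EuclideanSpace ℝ (Fin d))).restrict (Metric.ball 0 R))
      (F := fun n ξ => ‖𝓕 (toSchwartz (ψ n)) ξ‖ ^ 2) (f := fun _ => 0)
      (fun _ => (A * V + A * V) ^ 2)
      (fun n => ((𝓕 (toSchwartz (ψ n))).continuous.norm.pow 2).aestronglyMeasurable)
      (integrable_const _) ?_ ?_
    · simpa using h
    · refine fun n => ae_of_all _ fun ξ => ?_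
      obtain ⟨c, s, hc, hs, hφ⟩ := fourier_toSchwartz (O := O) ξ
      have hA0 : 0 ≤ A := (norm_nonneg _).trans (hA n)
      have key : ∀ w : O.L 2, ‖w‖ ≤ V → ‖(inner ℝ (O.testPair (ψ n)).1 w : ℝ)‖ ≤ A * V :=
        fun w hw => (norm_inner_le_norm _ _).trans (mul_le_mul (hA n) hw (norm_nonneg _) hA0)
      rw [hφ, norm_pow, norm_norm]
      refine pow_le_pow_left₀ (norm_nonneg _) ((norm_sub_le _ _).trans ?_) 2
      rw [norm_mul, Complex.norm_I, mul_one, Complex.norm_real, Complex.norm_real]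
      exact add_le_add (key c hc) (key s hs)
    · refine ae_of_all _ fun ξ => ?_
      obtain ⟨c, s, -, -, hφ⟩ := fourier_toSchwartz (O := O) ξ
      simp_rw [hφ]
      have h1 := (Complex.continuous_ofReal.tendsto 0).comp (hw c)
      have h2 := (Complex.continuous_ofReal.tendsto 0).comp (hw s)
      simpa using! ((h1.sub (h2.mul_const Complex.I)).norm.pow 2)
  have hsq : Tendsto (fun n => ‖(O.testPair (ψ n)).1‖ ^ 2) atTop (𝓝 0) := by
    rw [tendsto_order]
    refine ⟨fun a ha => Eventually.of_forall fun n => ha.trans_le (by positivity), fun ε hε => ?_⟩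
    -- frequencies above `R` contribute at most `B² / (2πR)²`, less than `ε / 2` for large `R`
    have hR : Tendsto (fun R : ℝ => ((2 * Real.pi * R) ^ 2)⁻¹ * B ^ 2) atTop (𝓝 0) := by
      have : Tendsto (fun R : ℝ => (2 * Real.pi * R) ^ 2) atTop atTop :=
        (tendsto_pow_atTop two_ne_zero).comp (tendsto_id.const_mul_atTop (by positivity))
      simpa using this.inv_tendsto_atTop.mul_const (B ^ 2)
    obtain ⟨R, hR1, hR2⟩ :=
      ((eventually_gt_atTop 0).and (hR.eventually_lt_const (half_pos hε))).exists
    filter_upwards [(hball R).eventually_lt_const (half_pos hε)] with n hn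
    have h1 := norm_sq_testPair_le (ψ n) hR1
    have h2 : ((2 * Real.pi * R) ^ 2)⁻¹ * ‖(O.testPair (ψ n)).2‖ ^ 2
        ≤ ((2 * Real.pi * R) ^ 2)⁻¹ * B ^ 2 := by
      gcongr; exact hB n
    linarith
  rw [tendsto_zero_iff_norm_tendsto_zero]
  have := (Real.continuous_sqrt.tendsto 0).comp hsq
  simpa [Function.comp_def, Real.sqrt_sq (norm_nonneg _)] using this

/-! ### Compactness in `H_0^1` -/

theorem inner_toLp_eq_integral {w : EuclideanSpace ℝ (Fin d) → ℝ} (hw : MemLp w 2 O.vol)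
    (u : O.L 2) : inner ℝ u (hw.toLp w) = ∫ x, u x * w x ∂O.vol := by
  rw [L2.inner_def]
  refine integral_congr_ae ?_
  filter_upwards [hw.coeFn_toLp] with x hx
  rw [hx]; simp [mul_comm]

theorem memLp_smul_single (φ : 𝓓(O.toOpens, ℝ)) (i : Fin d) :
    MemLp (fun x => EuclideanSpace.single i (φ x)) 2 O.vol := by
  have e : (fun x => EuclideanSpace.single i (φ x))
      = fun x => φ x • (EuclideanSpace.single i 1 : EuclideanSpace ℝ (Fin d)) := by
    funext x; ext j; simp
  have hc : Continuous fun x => (EuclideanSpace.single i (φ x) : EuclideanSpace ℝ (Fin d)) := by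
    rw [e]; exact φ.continuous.smul continuous_const
  exact (memLp_testFunction φ).of_le hc.aestronglyMeasurable (ae_of_all _ fun x => by simp)

theorem inner_vec_toLp_eq_integral (φ : 𝓓(O.toOpens, ℝ)) (i : Fin d) (G : O.L2Vec) :
    inner ℝ G ((memLp_smul_single φ i).toLp _) = ∫ x, G x i * φ x ∂O.vol := by
  rw [L2.inner_def]
  refine integral_congr_ae ?_
  filter_upwards [(memLp_smul_single φ i).coeFn_toLp] with x hx
  rw [hx, EuclideanSpace.inner_single_right]; simp [mul_comm]

theorem memLp_fderiv (φ : 𝓓(O.toOpens, ℝ)) (i : Fin d) :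
    MemLp (fun x => fderiv ℝ φ x (EuclideanSpace.single i 1)) 2 O.vol :=
  (((φ.contDiff.continuous_fderiv (by simp)).clm_apply
    continuous_const)).memLp_of_hasCompactSupport (φ.hasCompactSupport.fderiv_apply (𝕜 := ℝ) _)

/-- Weak gradients pass to weak limits. -/
theorem IsWeakGrad.of_tendsto_inner {u : ℕ → O.L 2} {G : ℕ → O.L2Vec} {u₀ : O.L 2} {G₀ : O.L2Vec}
    (h : ∀ n, O.IsWeakGrad (u n) (G n))
    (hu : ∀ y, Tendsto (fun n => inner ℝ (u n) y) atTop (𝓝 (inner ℝ u₀ y)))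
    (hG : ∀ y, Tendsto (fun n => inner ℝ (G n) y) atTop (𝓝 (inner ℝ G₀ y))) :
    O.IsWeakGrad u₀ G₀ := by
  intro φ i
  have h1 := hu ((memLp_fderiv φ i).toLp _)
  have h2 := (hG ((memLp_smul_single φ i).toLp _)).neg
  simp only [inner_toLp_eq_integral, inner_vec_toLp_eq_integral] at h1 h2
  refine tendsto_nhds_unique h1 (h2.congr fun n => ?_)
  exact (h n φ i).symm

/-- Weak limits of pairs `(u n, ∇(u n))` with `u n ∈ H_0^1(O)` are of the same form. -/
theorem exists_mem_H01_of_tendsto_inner {u : ℕ → O.H1} (hmem : ∀ n, u n ∈ O.H01)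
    {u₀ : O.L 2} {G₀ : O.L2Vec}
    (hu : ∀ y, Tendsto (fun n => inner ℝ (u n : O.L 2) y) atTop (𝓝 (inner ℝ u₀ y)))
    (hG : ∀ y, Tendsto (fun n => inner ℝ (O.grad (u n)) y) atTop (𝓝 (inner ℝ G₀ y))) :
    ∃ w : O.H1, w ∈ O.H01 ∧ (w : O.L 2) = u₀ ∧ O.grad w = G₀ := by
  have hw := IsWeakGrad.of_tendsto_inner (fun n => O.isWeakGrad_grad (u n)) hu hG
  let w : O.H1 := ⟨u₀, G₀, hw⟩
  have hg : O.grad w = G₀ := (O.isWeakGrad_grad w).unique hw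
  refine ⟨w, ?_, rfl, hg⟩
  change ((w : O.L 2), O.grad w) ∈ (LinearMap.range O.testPair).topologicalClosure
  rw [hg]
  exact Submodule.mem_of_tendsto_inner_prod
    (x := fun n => ((u n : O.L 2), O.grad (u n)))
    (Submodule.isClosed_topologicalClosure _) (fun n => hmem n) hu hG

/-- **Rellich's theorem** for `H_0^1(O)`: a sequence bounded in `H_0^1(O)` that converges weakly in
`L²(O)` to a limit in `H_0^1(O)` converges strongly in `L²(O)`. -/
theorem tendsto_of_tendsto_inner {u : ℕ → O.H1} (hmem : ∀ n, u n ∈ O.H01) {w : O.H1}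
    (hw : w ∈ O.H01) {A B : ℝ} (hA : ∀ n, ‖(u n : O.L 2)‖ ≤ A) (hB : ∀ n, ‖O.grad (u n)‖ ≤ B)
    (hu : ∀ y, Tendsto (fun n => inner ℝ (u n : O.L 2) y) atTop (𝓝 (inner ℝ (w : O.L 2) y))) :
    Tendsto (fun n => (u n : O.L 2)) atTop (𝓝 (w : O.L 2)) := by
  -- `u n - w` lies in `H_0^1(O)`, so it is within `1 / (n + 1)` of a test function
  have hψ : ∀ n : ℕ, ∃ ψ : 𝓓(O.toOpens, ℝ),
      ‖((u n - w : O.H1) : O.L 2) - (O.testPair ψ).1‖ ≤ 1 / ((n : ℝ) + 1) ∧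
      ‖O.grad (u n - w) - (O.testPair ψ).2‖ ≤ 1 / ((n : ℝ) + 1) := by
    intro n
    have h : (((u n - w : O.H1) : O.L 2), O.grad (u n - w)) ∈
        closure (LinearMap.range O.testPair : Set (O.L 2 × O.L2Vec)) :=
      O.H01.sub_mem (hmem n) hw
    obtain ⟨_, ⟨ψ, rfl⟩, hd⟩ := Metric.mem_closure_iff.1 h (1 / ((n : ℝ) + 1)) (by positivity)
    rw [dist_eq_norm, Prod.norm_def, max_lt_iff] at hd
    exact ⟨ψ, hd.1.le, hd.2.le⟩
  choose ψ h1 h2 using hψ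
  have hle : ∀ n : ℕ, 1 / ((n : ℝ) + 1) ≤ 1 := fun n => by
    rw [div_le_one (by positivity)]; linarith [n.cast_nonneg (α := ℝ)]
  have hdiff : Tendsto (fun n => ((u n - w : O.H1) : O.L 2) - (O.testPair (ψ n)).1) atTop (𝓝 0) :=
    squeeze_zero_norm h1 tendsto_one_div_add_atTop_nhds_zero_nat
  have hψ0 : Tendsto (fun n => (O.testPair (ψ n)).1) atTop (𝓝 0) := by
    refine tendsto_testPair_zero (A := A + ‖(w : O.L 2)‖ + 1) (B := B + ‖O.grad w‖ + 1)
      (fun n => ?_) (fun n => ?_) fun y => ?_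
    · have := norm_le_norm_add_norm_sub ((u n - w : O.H1) : O.L 2) (O.testPair (ψ n)).1
      have h3 : ‖((u n - w : O.H1) : O.L 2)‖ ≤ ‖(u n : O.L 2)‖ + ‖(w : O.L 2)‖ := norm_sub_le _ _
      linarith [h1 n, hle n, hA n]
    · have := norm_le_norm_add_norm_sub (O.grad (u n - w)) (O.testPair (ψ n)).2
      have h3 : ‖O.grad (u n - w)‖ ≤ ‖O.grad (u n)‖ + ‖O.grad w‖ := by
        rw [map_sub]; exact norm_sub_le _ _
      linarith [h2 n, hle n, hB n]
    · have h3 := (hu y).sub_const (inner ℝ (w : O.L 2) y)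
      have h4 := hdiff.inner (tendsto_const_nhds (x := y)) (𝕜 := ℝ)
      rw [inner_zero_left] at h4
      have h5 := h3.sub h4
      rw [sub_self, sub_zero] at h5
      refine h5.congr fun n => ?_
      have h6 : ((u n - w : O.H1) : O.L 2) = (u n : O.L 2) - (w : O.L 2) := rfl
      rw [inner_sub_left, h6, inner_sub_left]
      ring
  have h7 := (hdiff.add hψ0).add_const (w : O.L 2)
  rw [add_zero, zero_add] at h7
  refine h7.congr fun n => ?_
  have h6 : ((u n - w : O.H1) : O.L 2) = (u n : O.L 2) - (w : O.L 2) := rfl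
  rw [h6]; abel

/-- Bounded sequences in `H_0^1(O)` have subsequences converging strongly in `L²(O)`, with gradients
converging weakly. -/
theorem exists_subseq_tendsto {u : ℕ → O.H1} (hmem : ∀ n, u n ∈ O.H01) {A B : ℝ}
    (hA : ∀ n, ‖(u n : O.L 2)‖ ≤ A) (hB : ∀ n, ‖O.grad (u n)‖ ≤ B) :
    ∃ (w : O.H1) (k : ℕ → ℕ), w ∈ O.H01 ∧ StrictMono k ∧
      Tendsto (fun n => (u (k n) : O.L 2)) atTop (𝓝 (w : O.L 2)) ∧
      ∀ y, Tendsto (fun n => inner ℝ (O.grad (u (k n))) y) atTop (𝓝 (inner ℝ (O.grad w) y)) := by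
  have : Fact ((2 : ℝ≥0∞) ≠ ⊤) := ⟨by simp⟩
  obtain ⟨u₀, k, hk, hu⟩ := exists_subseq_tendsto_inner hA
  obtain ⟨G₀, l, hl, hG⟩ := exists_subseq_tendsto_inner fun n => hB (k n)
  have hu' := fun y => (hu y).comp hl.tendsto_atTop
  obtain ⟨w, hw, rfl, rfl⟩ := exists_mem_H01_of_tendsto_inner (u := fun n => u (k (l n)))
    (fun n => hmem _) hu' hG
  exact ⟨w, fun n => k (l n), hw, hk.comp hl,
    tendsto_of_tendsto_inner (fun n => hmem _) hw (fun n => hA _) (fun n => hB _) hu', hG⟩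

/-! ### Existence of a minimizer -/

theorem gradSq_eq (u : O.H1) : O.gradSq u = ‖O.grad u‖ ^ 2 := (norm_sq_toLp _).symm

theorem powInt_nonneg (p : ℝ) (u : O.H1) : 0 ≤ O.powInt p u :=
  integral_nonneg fun x => by positivity

theorem integrable_abs_rpow {p : ℝ} (hp : 0 < p) {f : EuclideanSpace ℝ (Fin d) → ℝ}
    (hf : MemLp f (ENNReal.ofReal p) O.vol) : Integrable (fun x => |f x| ^ p) O.vol := by
  have := hf.integrable_norm_rpow (by simpa using hp) (by simp)
  rwa [ENNReal.toReal_ofReal hp.le] at this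

theorem energy_nonneg {p : ℝ} (hp : 0 < p) (u : O.LpH01 p) : 0 ≤ O.energy p u := by
  have := O.powInt_nonneg p u
  rw [energy, gradSq_eq]
  positivity

/-- Fatou's lemma for `∫ |u|^p`, along a sequence that converges in `L²(O)`. -/
theorem memLp_and_powInt_le {p : ℝ} (hp : 0 < p) {u : ℕ → O.LpH01 p} {w : O.H1}
    (h : Tendsto (fun n => ((u n : O.H1) : O.L 2)) atTop (𝓝 (w : O.L 2))) {c : ℕ → ℝ} {c₀ : ℝ}
    (hc : ∀ n, O.powInt p (u n) ≤ c n) (hc₀ : Tendsto c atTop (𝓝 c₀)) :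
    MemLp (w : O.L 2) (ENNReal.ofReal p) O.vol ∧ O.powInt p w ≤ c₀ := by
  obtain ⟨k, hk, hae⟩ := (tendstoInMeasure_of_tendsto_Lp h).exists_seq_tendsto_ae
  have hmeas : ∀ f : O.L 2, AEMeasurable (fun x => ENNReal.ofReal (|f x| ^ p)) O.vol := fun f =>
    (((Lp.aestronglyMeasurable f).aemeasurable.abs).pow_const p).ennreal_ofReal
  have key : ∫⁻ x, ENNReal.ofReal (|(w : O.L 2) x| ^ p) ∂O.vol ≤ ENNReal.ofReal c₀ := by
    calc ∫⁻ x, ENNReal.ofReal (|(w : O.L 2) x| ^ p) ∂O.vol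
        = ∫⁻ x, liminf (fun n => ENNReal.ofReal (|((u (k n) : O.H1) : O.L 2) x| ^ p)) atTop
            ∂O.vol := by
          refine lintegral_congr_ae ?_
          filter_upwards [hae] with x hx
          refine (Tendsto.liminf_eq ?_).symm
          exact ENNReal.tendsto_ofReal (hx.abs.rpow_const (Or.inr hp.le))
      _ ≤ liminf (fun n => ∫⁻ x, ENNReal.ofReal (|((u (k n) : O.H1) : O.L 2) x| ^ p) ∂O.vol)
            atTop := lintegral_liminf_le' fun n => hmeas _
      _ ≤ liminf (fun n => ENNReal.ofReal (c (k n))) atTop := by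
          refine liminf_le_liminf (Eventually.of_forall fun n => ?_)
          rw [← ofReal_integral_eq_lintegral_ofReal (integrable_abs_rpow hp (u (k n)).2.2)
            (ae_of_all _ fun x => by positivity)]
          exact ENNReal.ofReal_le_ofReal (hc _)
      _ = ENNReal.ofReal c₀ :=
          (ENNReal.tendsto_ofReal (hc₀.comp hk.tendsto_atTop)).liminf_eq
  have hc0 : 0 ≤ c₀ := ge_of_tendsto' hc₀ fun n => (O.powInt_nonneg p _).trans (hc n)
  have hint : Integrable (fun x => |(w : O.L 2) x| ^ p) O.vol := by
    refine ⟨((Lp.aestronglyMeasurable _).aemeasurable.abs.pow_const p).aestronglyMeasurable, ?_⟩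
    rw [hasFiniteIntegral_iff_ofReal (ae_of_all _ fun x => by positivity)]
    exact key.trans_lt ENNReal.ofReal_lt_top
  refine ⟨?_, ?_⟩
  · rw [← integrable_norm_rpow_iff (Lp.aestronglyMeasurable _) (by simpa using hp) (by simp),
      ENNReal.toReal_ofReal hp.le]
    exact hint
  · rw [← ENNReal.ofReal_le_ofReal_iff hc0, powInt,
      ofReal_integral_eq_lintegral_ofReal hint (ae_of_all _ fun x => by positivity)]
    exact key

/-- The direct method: if the constraint set is nonempty, the energy attains its minimum on it. -/
theorem exists_isMinimizer {p : ℝ} (hp : 0 < p) (hne : (O.sphere p).Nonempty) :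
    ∃ u : O.LpH01 p, O.IsMinimizer p u := by
  obtain ⟨e, -, he, hmem⟩ := exists_seq_tendsto_sInf (hne.image (O.energy p))
    ⟨0, by rintro _ ⟨u, -, rfl⟩; exact energy_nonneg hp u⟩
  set m := sInf (O.energy p '' O.sphere p)
  choose u hu hue using hmem
  obtain ⟨M, hM⟩ := he.bddAbove_range
  have hB : ∀ n, ‖O.grad (u n)‖ ≤ √(2 * M) := by
    intro n
    refine Real.le_sqrt_of_sq_le ?_
    have h1 : O.energy p (u n) ≤ M := by rw [hue]; exact hM ⟨n, rfl⟩
    have h2 := O.powInt_nonneg p (u n)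
    have h3 : 0 ≤ 1 / p * O.powInt p (u n) := by positivity
    rw [energy, gradSq_eq] at h1
    linarith
  obtain ⟨w, k, hw, hk, hlim, hG⟩ := exists_subseq_tendsto (u := fun n => (u n : O.H1))
    (fun n => (u n).2.1) (A := 1) (fun n => (hu n).le) hB
  -- `½‖∇u‖² ≥ ⟨∇u, ∇w⟩ - ½‖∇w‖²` bounds the `L^p` part of the energy from above by a
  -- convergent sequence
  have hc : ∀ n, O.powInt p (u (k n)) ≤
      p * (e (k n) - inner ℝ (O.grad (u (k n))) (O.grad w) + 1 / 2 * ‖O.grad w‖ ^ 2) := by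
    intro n
    have h1 : 1 / 2 * ‖O.grad (u (k n))‖ ^ 2 + 1 / p * O.powInt p (u (k n)) = e (k n) := by
      rw [← gradSq_eq]; exact hue _
    have h2 := norm_sub_sq_real (O.grad (u (k n))) (O.grad w)
    have h3 := sq_nonneg ‖O.grad (u (k n)) - O.grad w‖
    have h4 : O.powInt p (u (k n)) = p * (1 / p * O.powInt p (u (k n))) := by field_simp
    rw [h4]
    exact mul_le_mul_of_nonneg_left (by linarith) hp.le
  have hc₀ := (((he.comp hk.tendsto_atTop).sub (hG (O.grad w))).add_const
    (1 / 2 * ‖O.grad w‖ ^ 2)).const_mul p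
  obtain ⟨hwp, hle⟩ := memLp_and_powInt_le hp (u := fun n => u (k n)) hlim hc hc₀
  refine ⟨⟨w, hw, hwp⟩, ?_, ?_⟩
  · exact tendsto_nhds_unique hlim.norm ((tendsto_const_nhds (x := (1 : ℝ))).congr
      fun n => (hu (k n)).symm)
  · intro v hv
    have h1 : m ≤ O.energy p v := csInf_le
      ⟨0, by rintro _ ⟨u, -, rfl⟩; exact energy_nonneg hp u⟩ ⟨v, hv, rfl⟩
    refine le_trans ?_ h1
    change 1 / 2 * O.gradSq w + 1 / p * O.powInt p w ≤ m
    rw [real_inner_self_eq_norm_sq] at hle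
    have h2 : 1 / p * O.powInt p w ≤ m - ‖O.grad w‖ ^ 2 + 1 / 2 * ‖O.grad w‖ ^ 2 := by
      rw [one_div, inv_mul_le_iff₀ hp]; exact hle
    rw [gradSq_eq]
    linarith

/-! ### The Euler-Lagrange equation -/

/-- Differentiation under the integral sign, dominated for `|t| < 1` by `p (|u| + |v|)^p`. -/
theorem hasDerivAt_powInt {p : ℝ} (hp : 2 ≤ p) (u v : O.LpH01 p) :
    HasDerivAt (fun t : ℝ => O.powInt p (u + t • v : O.LpH01 p))
      (p * ∫ x, |((u : O.H1) : O.L 2) x| ^ (p - 2) * ((u : O.H1) : O.L 2) x *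
        ((v : O.H1) : O.L 2) x ∂O.vol) 0 := by
  have hp0 : 0 < p := by linarith
  set f : EuclideanSpace ℝ (Fin d) → ℝ := ⇑((u : O.H1) : O.L 2)
  set g : EuclideanSpace ℝ (Fin d) → ℝ := ⇑((v : O.H1) : O.L 2)
  have hfm : MemLp f (ENNReal.ofReal p) O.vol := u.2.2
  have hgm : MemLp g (ENNReal.ofReal p) O.vol := v.2.2
  have e : ∀ t : ℝ, O.powInt p (u + t • v : O.LpH01 p) = ∫ x, |f x + t * g x| ^ p ∂O.vol := by
    intro t
    refine integral_congr_ae ?_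
    filter_upwards [Lp.coeFn_add ((u : O.H1) : O.L 2) (t • ((v : O.H1) : O.L 2)),
      Lp.coeFn_smul t ((v : O.H1) : O.L 2)] with x hx hx'
    have h : (((u + t • v : O.LpH01 p) : O.H1) : O.L 2) x = f x + t * g x := by
      refine hx.trans ?_
      rw [Pi.add_apply, hx']; rfl
    rw [h]
  simp_rw [e]
  have hfa := hfm.aestronglyMeasurable.aemeasurable
  have hga := hgm.aestronglyMeasurable.aemeasurable
  have h := hasDerivAt_integral_of_dominated_loc_of_deriv_le (μ := O.vol) (𝕜 := ℝ)
    (F := fun t x => |f x + t * g x| ^ p) (x₀ := 0) (s := Metric.ball 0 1)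
    (F' := fun t x => p * |f x + t * g x| ^ (p - 2) * (f x + t * g x) * g x)
    (bound := fun x => p * |(|f x| + |g x|)| ^ p)
    (Metric.ball_mem_nhds _ one_pos)
    (Eventually.of_forall fun t => (((hfa.add (hga.const_mul t)).abs).pow_const
      p).aestronglyMeasurable) ?_ ?_ ?_ ?_ ?_
  · refine h.2.congr_deriv ?_
    rw [← integral_const_mul]
    simp only [zero_mul, add_zero, mul_assoc]
  · simpa using integrable_abs_rpow hp0 hfm
  · simp only [zero_mul, add_zero]
    exact (((hfa.abs.pow_const _).const_mul p).mul hfa |>.mul hga).aestronglyMeasurable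
  · refine ae_of_all _ fun x t ht => ?_
    have ht1 : |t| ≤ 1 := by
      have := Metric.mem_ball.1 ht
      rw [Real.dist_eq, sub_zero] at this
      exact this.le
    have h1 : |f x + t * g x| ≤ |f x| + |g x| := by
      refine (abs_add_le _ _).trans ?_
      rw [abs_mul]
      have := mul_le_mul_of_nonneg_right ht1 (abs_nonneg (g x))
      linarith
    have h2 : |g x| ≤ |f x| + |g x| := by linarith [abs_nonneg (f x)]
    have h0 : 0 ≤ |f x| + |g x| := by positivity
    rw [Real.norm_eq_abs, abs_mul, abs_mul, abs_mul, abs_of_pos hp0,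
      Real.abs_rpow_of_nonneg (abs_nonneg _), abs_abs, abs_of_nonneg h0]
    have h3 : (|f x| + |g x|) ^ p
        = (|f x| + |g x|) ^ (p - 2) * (|f x| + |g x|) * (|f x| + |g x|) := by
      rw [mul_assoc, ← sq, ← Real.rpow_two,
        ← Real.rpow_add_of_nonneg h0 (by linarith) (by norm_num)]
      congr 1; ring
    rw [h3, mul_assoc, mul_assoc, mul_assoc]
    gcongr
  · exact (integrable_abs_rpow hp0 (hfm.abs.add hgm.abs)).const_mul p
  · refine ae_of_all _ fun x t _ => ?_
    have h1 : HasDerivAt (fun t : ℝ => f x + t * g x) (g x) t := by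
      simpa using ((hasDerivAt_id t).mul_const (g x)).const_add (f x)
    exact (hasDerivAt_abs_rpow _ (by linarith)).comp t h1

theorem powInt_smul (p : ℝ) (c : ℝ) (u : O.H1) : O.powInt p (c • u) = |c| ^ p * O.powInt p u := by
  rw [powInt, powInt, ← integral_const_mul]
  refine integral_congr_ae ?_
  filter_upwards [Lp.coeFn_smul c (u : O.L 2)] with x hx
  have h : ((c • u : O.H1) : O.L 2) x = c * (u : O.L 2) x := hx
  rw [h, abs_mul, Real.mul_rpow (abs_nonneg _) (abs_nonneg _)]

theorem energy_normalize {p : ℝ} (u : O.LpH01 p) {N : ℝ} (hN : 0 < N) :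
    O.energy p (N⁻¹ • u) = 1 / 2 * (‖O.grad u‖ ^ 2 * (N ^ 2)⁻¹) +
      1 / p * (O.powInt p u * N ^ (-p)) := by
  have h1 : ((N⁻¹ • u : O.LpH01 p) : O.H1) = N⁻¹ • (u : O.H1) := rfl
  rw [energy, h1, powInt_smul, gradSq_eq, map_smul, norm_smul, mul_pow, norm_inv,
    Real.norm_of_nonneg hN.le, abs_of_pos (inv_pos.2 hN), Real.inv_rpow hN.le,
    ← Real.rpow_neg hN.le, inv_pow]
  ring

theorem _root_.hasDerivAt_norm_add_smul_sq {H : Type*} [NormedAddCommGroup H]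
    [InnerProductSpace ℝ H] (a b : H) :
    HasDerivAt (fun t : ℝ => ‖a + t • b‖ ^ 2) (2 * inner ℝ a b) 0 := by
  have h1 : HasDerivAt (fun t : ℝ => a + t • b) b 0 := by
    simpa using ((hasDerivAt_id (0 : ℝ)).smul_const b).const_add a
  simpa using h1.norm_sq

/-- The Euler-Lagrange equation of the constrained minimization problem. -/
theorem IsMinimizer.euler_lagrange {p : ℝ} (hp : 2 ≤ p) {u : O.LpH01 p} (hu : O.IsMinimizer p u)
    (v : O.LpH01 p) :
    inner ℝ (O.grad u) (O.grad v) + (∫ x, |((u : O.H1) : O.L 2) x| ^ (p - 2) *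
        ((u : O.H1) : O.L 2) x * ((v : O.H1) : O.L 2) x ∂O.vol)
      = (O.gradSq u + O.powInt p u) * inner ℝ ((u : O.H1) : O.L 2) ((v : O.H1) : O.L 2) := by
  have hp0 : p ≠ 0 := by linarith
  set a : O.L 2 := ((u : O.H1) : O.L 2) with ha
  set b : O.L 2 := ((v : O.H1) : O.L 2) with hb
  have hnorm : ‖a‖ = 1 := hu.1
  have hN2 := hasDerivAt_norm_add_smul_sq a b
  have hN : HasDerivAt (fun t : ℝ => ‖a + t • b‖) (inner ℝ a b) 0 := by
    have h := hN2.sqrt (by simp [hnorm])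
    simp only [Real.sqrt_sq (norm_nonneg _)] at h
    refine h.congr_deriv ?_
    simp [hnorm]
  have hG := hasDerivAt_norm_add_smul_sq (O.grad u) (O.grad v)
  have hP := hasDerivAt_powInt hp u v
  have hNp : HasDerivAt (fun t : ℝ => ‖a + t • b‖ ^ (-p)) (-p * inner ℝ a b) 0 := by
    refine (hN.rpow_const (p := -p) (Or.inl (by simp [hnorm]))).congr_deriv ?_
    simp [hnorm]; ring
  have hNi : HasDerivAt (fun t : ℝ => (‖a + t • b‖ ^ 2)⁻¹) (-(2 * inner ℝ a b)) 0 := by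
    refine (hN2.fun_inv (by simp [hnorm])).congr_deriv ?_
    simp [hnorm]
  have hE := ((hG.mul hNi).const_mul (1 / 2)).add ((hP.mul hNp).const_mul (1 / p))
  -- the energy along the normalized curve `(u + t v) / ‖u + t v‖` is minimal at `t = 0`
  have hpos : ∀ᶠ t in 𝓝 (0 : ℝ), 0 < ‖a + t • b‖ :=
    hN.continuousAt.eventually_const_lt (by simp [hnorm])
  have hmin : IsLocalMin (fun t : ℝ => O.energy p (‖a + t • b‖⁻¹ • (u + t • v))) 0 := by
    filter_upwards [hpos] with t ht
    have hz : ‖a + (0 : ℝ) • b‖⁻¹ • (u + (0 : ℝ) • v) = u := by simp [hnorm]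
    rw [hz]
    refine hu.2 ?_
    change ‖‖a + t • b‖⁻¹ • (a + t • b)‖ = 1
    rw [norm_smul, norm_inv, norm_norm, inv_mul_cancel₀ ht.ne']
  have h0 := hmin.hasDerivAt_eq_zero (hE.congr_of_eventuallyEq (by
    filter_upwards [hpos] with t ht
    rw [energy_normalize _ ht]
    have : O.grad ((u + t • v : O.LpH01 p) : O.H1) = O.grad u + t • O.grad v := by
      rw [← map_smul, ← map_add]; rfl
    rw [this]; rfl))
  simp only [zero_smul, add_zero, hnorm, one_pow, inv_one, Real.one_rpow, mul_one] at h0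
  rw [gradSq_eq]
  field_simp at h0
  linarith

theorem IsMinimizer.stationary_eq_zero {p : ℝ} (hp : 2 ≤ p) {u : O.LpH01 p}
    (hu : O.IsMinimizer p u) : O.stationary hp u = 0 := by
  refine Subtype.ext (LinearMap.ext fun v => ?_)
  have h1 : ∫ x, O.nonlinearity hp u x * ((v : O.H1) : O.L 2) x ∂O.vol
      = ∫ x, |((u : O.H1) : O.L 2) x| ^ (p - 2) * ((u : O.H1) : O.L 2) x *
        ((v : O.H1) : O.L 2) x ∂O.vol := by
    refine integral_congr_ae ?_
    filter_upwards [(O.memLp_nonlinearity hp u).coeFn_toLp] with x hx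
    rw [nonlinearity, hx]
  have h2 : ∫ x, O.toLpConj hp u x * ((v : O.H1) : O.L 2) x ∂O.vol
      = inner ℝ ((u : O.H1) : O.L 2) ((v : O.H1) : O.L 2) := by
    rw [L2.inner_def]
    refine integral_congr_ae ?_
    filter_upwards [((Lp.memLp ((u : O.H1) : O.L 2)).mono_exponent
      (conjExp_le_two hp)).coeFn_toLp] with x hx
    rw [toLpConj, hx]; simp [mul_comm]
  have h3 := hu.euler_lagrange hp v
  -- the stationary functional evaluated at `v`, unfolded
  change -inner ℝ (O.grad u) (O.grad v)
    - (∫ x, O.nonlinearity hp u x * ((v : O.H1) : O.L 2) x ∂O.vol)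
    + (O.gradSq u + O.powInt p u) *
      (∫ x, O.toLpConj hp u x * ((v : O.H1) : O.L 2) x ∂O.vol) = 0
  rw [h1, h2]
  linarith

/-! ### The constraint set is nonempty -/

/-- Integration by parts: the classical gradient of a test function is its weak gradient. -/
theorem isWeakGrad_testPair (φ : 𝓓(O.toOpens, ℝ)) :
    O.IsWeakGrad (O.testPair φ).1 (O.testPair φ).2 := by
  intro ψ i
  have e1 : ∫ x, (O.testPair φ).1 x * fderiv ℝ ψ x (EuclideanSpace.single i 1) ∂O.vol
      = ∫ x, φ x * fderiv ℝ ψ x (EuclideanSpace.single i 1) := by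
    rw [← setIntegral_eq_integral_of_support (O := O)]
    · refine integral_congr_ae ?_
      filter_upwards [(memLp_testFunction φ).coeFn_toLp] with x hx
      have : (O.testPair φ).1 x = φ x := hx
      rw [this]
    · intro x hx
      exact φ.tsupport_subset (subset_tsupport _ fun h => hx (by simp [h]))
  have e2 : ∫ x, (O.testPair φ).2 x i * ψ x ∂O.vol
      = ∫ x, fderiv ℝ φ x (EuclideanSpace.single i 1) * ψ x := by
    rw [← setIntegral_eq_integral_of_support (O := O)]
    · refine integral_congr_ae ?_
      filter_upwards [(memLp_gradient φ).coeFn_toLp] with x hx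
      have h : (O.testPair φ).2 x = ∇ φ x := hx
      rw [h, gradient_apply]
    · intro x hx
      exact ψ.tsupport_subset (subset_tsupport _ fun h => hx (by simp [h]))
  have c : ∀ χ : 𝓓(O.toOpens, ℝ),
      Continuous fun x => fderiv ℝ χ x (EuclideanSpace.single i 1) := fun χ =>
    (χ.contDiff.continuous_fderiv (by simp)).clm_apply continuous_const
  rw [e1, e2]
  exact integral_mul_fderiv_eq_neg_fderiv_mul_of_integrable
    (((c φ).mul ψ.continuous).integrable_of_hasCompactSupport ψ.hasCompactSupport.mul_left)
    ((φ.continuous.mul (c ψ)).integrable_of_hasCompactSupport φ.hasCompactSupport.mul_right)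
    ((φ.continuous.mul ψ.continuous).integrable_of_hasCompactSupport
      φ.hasCompactSupport.mul_right)
    (fun x _ => φ.contDiff.differentiable (by simp) x)
    (fun x _ => ψ.contDiff.differentiable (by simp) x)

/-- A test function, as an element of `L^p(O) ∩ H_0^1(O)`. -/
noncomputable def ofTest (p : ℝ) (φ : 𝓓(O.toOpens, ℝ)) : O.LpH01 p :=
  ⟨⟨(O.testPair φ).1, _, isWeakGrad_testPair φ⟩, by
    have hg : O.grad ⟨(O.testPair φ).1, _, isWeakGrad_testPair φ⟩ = (O.testPair φ).2 :=
      (O.isWeakGrad_grad _).unique (isWeakGrad_testPair φ)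
    refine ⟨?_, ?_⟩
    · change (_, O.grad _) ∈ (LinearMap.range O.testPair).topologicalClosure
      rw [hg]
      exact Submodule.le_topologicalClosure _ ⟨φ, rfl⟩
    · exact (memLp_congr_ae (memLp_testFunction φ).coeFn_toLp).2
        (φ.continuous.memLp_of_hasCompactSupport φ.hasCompactSupport)⟩

theorem exists_testFunction_ne_zero : ∃ φ : 𝓓(O.toOpens, ℝ), (O.testPair φ).1 ≠ 0 := by
  obtain ⟨x₀, hx₀⟩ := O.isConnected.nonempty
  obtain ⟨f, hsupp, hcomp, hsmooth, -, h1⟩ :=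
    exists_contDiff_tsupport_subset (n := ⊤) (O.is_open'.mem_nhds hx₀)
  let φ : 𝓓(O.toOpens, ℝ) := ⟨f, hsmooth, hcomp, hsupp⟩
  refine ⟨φ, fun h0 => ?_⟩
  have h2 : ∀ᵐ x ∂volume.restrict O.carrier, f x = 0 := by
    have hae : (O.testPair φ).1 =ᵐ[O.vol] φ := (memLp_testFunction φ).coeFn_toLp
    filter_upwards [hae, Lp.coeFn_zero ℝ 2 O.vol] with x hx hx'
    rw [h0] at hx
    exact hx.symm.trans hx'
  have h3 := Measure.eqOn_of_ae_eq (g := fun _ => (0 : ℝ)) h2 hsmooth.continuous.continuousOn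
    continuousOn_const (by rw [O.is_open'.interior_eq]; exact subset_closure) hx₀
  rw [h1] at h3
  exact one_ne_zero h3

theorem sphere_nonempty (p : ℝ) : (O.sphere p).Nonempty := by
  obtain ⟨φ, hφ⟩ := exists_testFunction_ne_zero (O := O)
  refine ⟨‖(O.testPair φ).1‖⁻¹ • ofTest p φ, ?_⟩
  change ‖‖(O.testPair φ).1‖⁻¹ • (O.testPair φ).1‖ = 1
  rw [norm_smul, norm_inv, norm_norm, inv_mul_cancel₀ (norm_ne_zero_iff.2 hφ)]

end BoundedDomain

theorem mainTheorem3 {d : ℕ} (hd : 1 ≤ d) (O : BoundedDomain d) {p : ℝ} (hp : 2 ≤ p) :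
    (∃ u : O.LpH01 p, O.IsGroundState hp u) ∧
      ∀ u : O.LpH01 p, O.IsMinimizer p u → O.IsGroundState hp u := by
  have key : ∀ u : O.LpH01 p, O.IsMinimizer p u → O.IsGroundState hp u := fun u hu =>
    ⟨hu, hu.stationary_eq_zero hp⟩
  obtain ⟨u, hu⟩ := O.exists_isMinimizer (by linarith) (O.sphere_nonempty p)
  exact ⟨⟨u, key u hu⟩, key⟩
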